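/- Let $G$ be a finite cyclic group. Then there is a commutative ring $R$ with identity whose group of units $R^*$ is isomorphic to $G$ if and only if $|G|$ is the product of the elements of a finite set of pairwise coprime positive integers each of which has at least one of the following forms (the empty product being $1$): (a) $p^\lambda-1$, where $p$ is a prime and $\lambda\ge 1$; (b) $(p-1)p^k$, where $p>2$ is a prime and $k\ge 1$; (c) $2d$, where $d>0$ is odd; (d) $4d$, where $d>0$ is odd and every prime factor of $d$ is congruent to $1$ modulo $4$. -/

import Mathlib

universe u v

/-- The natural numbers occurring in the list: `p ^ l - 1` with `p` prime and `l ≥ 1`;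
`(p - 1) * p ^ k` with `p > 2` prime and `k ≥ 1`; `2 * d` with `d` odd; and `4 * d` with `d` odd
and all prime factors of `d` congruent to `1` modulo `4`. The truncated subtractions are harmless
since `p ≥ 2` and `p ^ l ≥ 2`. -/
inductive IsListedOrder : ℕ → Prop
  | primePowSubOne (p l : ℕ) (hp : p.Prime) (hl : 1 ≤ l) : IsListedOrder (p ^ l - 1)
  | predMulPow (p k : ℕ) (hp : p.Prime) (hp2 : 2 < p) (hk : 1 ≤ k) :
      IsListedOrder ((p - 1) * p ^ k)
  | twoMul (d : ℕ) (hd : Odd d) : IsListedOrder (2 * d)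
  | fourMul (d : ℕ) (hd : Odd d) (h : ∀ q : ℕ, q.Prime → q ∣ d → q % 4 = 1) :
      IsListedOrder (4 * d)

/-!
A ring `R` whose group of units is finite and cyclic may be replaced by its subring generated by
the units, which is finitely generated over `ℤ` and has the same units. Noetherian induction splits
it along idempotents into connected rings; as `Rˣ` is cyclic, the unit groups of the factors have
coprime orders. So it suffices that a connected ring, finitely generated over `ℤ`, has a listed
number of units.

If the ring is finite, it is local. Unless it is a field, it has a nonzero `x` annihilated by the
maximal ideal, and the units `1 + a * x` form a copy of the additive group of the residue field
inside a cyclic group. The residue field is therefore `𝔽_p` and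
`|Rˣ| = (p - 1) * p ^ s`; for `p = 2` uniqueness of the unit of order two forces `|Rˣ| ∣ 4`
(`isListedOrder_natCard_units_of_finite`).

If the ring has characteristic zero, then `-1 ≠ 1` and `|Rˣ|` is even. Suppose that a generator
`g` has order `N = 4 * d`. Then `(1 + g) / (1 - g)` makes sense as a unit of `R`
(`one_add_pow_eq_one_sub_pow`), and since it has finite order, `(1 + g) ^ N = (1 - g) ^ N`. The
complex `N`-th roots of unity with this property are `i` and `-i`, so `g ^ 2 + 1` is torsion
(`exists_int_mul_sq_add_one_eq_zero`). This replaces Dirichlet's unit theorem. It follows that `d`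
is odd, and that every unit of odd prime order `q` is `1 + x` with `x` torsion, hence nilpotent by
connectedness. A suitable power `y` of `x` then spans a module over `ℤ[i]` with additive group of
order `q`, because `1 + ℤ[i] y` is a cyclic group, and so `-1` is a square modulo `q`
(`mod_four_eq_one_of_isNilpotent`).

Conversely the listed orders are realised by `𝔽_{p^l}`, `ℤ/p^(k+1)`, and the square-zero extensions
`ℤ ⊕ ℤ/d` and `ℤ[i] ⊕ ℤ/d`, and coprime orders are combined by products of rings.
-/

/-! ### Cyclic groups, idempotents and square-zero elements -/

/-- A finite cyclic group has at most one subgroup of prime order `p`. -/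
theorem IsCyclic.mem_zpowers_of_pow_prime_eq_one {G : Type*} [Group G] [Finite G] [IsCyclic G]
    {p : ℕ} (hp : p.Prime) {a b : G} (ha : a ^ p = 1) (ha1 : a ≠ 1) (hb : b ^ p = 1) :
    b ∈ Subgroup.zpowers a := by
  classical
  have := Fintype.ofFinite G
  by_contra hba
  have : Fact p.Prime := ⟨hp⟩
  have hord : orderOf a = p := orderOf_eq_prime ha ha1
  have hsub : insert b ((Finset.range p).image (a ^ ·)) ⊆
      Finset.univ.filter fun u : G ↦ u ^ p = 1 := by
    intro u hu
    simp only [Finset.mem_insert, Finset.mem_image, Finset.mem_filter, Finset.mem_univ,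
      true_and] at hu ⊢
    rcases hu with rfl | ⟨k, -, rfl⟩
    · exact hb
    · rw [← pow_mul, mul_comm, pow_mul, ha, one_pow]
  have hle := (Finset.card_le_card hsub).trans (IsCyclic.card_pow_eq_one_le hp.pos)
  rw [Finset.card_insert_of_notMem, Finset.card_image_of_injOn, Finset.card_range] at hle
  · omega
  · intro i hi j hj hij
    exact pow_injOn_Iio_orderOf (by simpa [hord] using hi) (by simpa [hord] using hj) hij
  · simp only [Finset.mem_image, not_exists, not_and]
    rintro k - rfl
    exact hba (Subgroup.npow_mem_zpowers a k)

theorem IsCyclic.eq_of_sq_eq_one {G : Type*} [Group G] [Finite G] [IsCyclic G] {a b : G}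
    (ha : a ^ 2 = 1) (ha1 : a ≠ 1) (hb : b ^ 2 = 1) (hb1 : b ≠ 1) : b = a := by
  obtain ⟨k, rfl⟩ := IsCyclic.mem_zpowers_of_pow_prime_eq_one Nat.prime_two ha ha1 hb
  rcases Int.even_or_odd' k with ⟨c, rfl | rfl⟩
  · exact absurd (by simp [zpow_mul, ha]) hb1
  · simp [zpow_add, zpow_mul, ha]

/-- In a ring whose only idempotents are `0` and `1`, an element with eventually periodic powers
is a unit or nilpotent, because some positive power of it is idempotent. -/
theorem isUnit_or_isNilpotent_of_pow_eq_pow {R : Type*} [CommRing R]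
    (hR : ∀ e : R, e * e = e → e = 0 ∨ e = 1) {x : R} {a b : ℕ} (hab : a < b)
    (h : x ^ a = x ^ b) : IsUnit x ∨ IsNilpotent x := by
  obtain ⟨c, hc, rfl⟩ : ∃ c, 0 < c ∧ b = a + c := ⟨b - a, by omega, by omega⟩
  have hper (n k : ℕ) (hn : a ≤ n) : x ^ (n + c * k) = x ^ n := by
    induction k with
    | zero => simp
    | succ k ih =>
      obtain ⟨d, hd⟩ := Nat.exists_eq_add_of_le (show a ≤ n + c * k by omega)
      rw [Nat.mul_succ, ← add_assoc, ← ih, hd, add_right_comm, pow_add, ← h, ← pow_add]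
  -- The exponent is a multiple of the period `c` that is at least `a`.
  have hidem : x ^ (c * (a + 1)) * x ^ (c * (a + 1)) = x ^ (c * (a + 1)) := by
    rw [← pow_add]
    exact hper _ _ (by nlinarith)
  rcases hR _ hidem with h0 | h1
  · exact Or.inr ⟨_, h0⟩
  · exact Or.inl (IsUnit.of_pow_eq_one h1 (by positivity))

theorem isUnit_or_isNilpotent_of_finite {R : Type*} [CommRing R] [Finite R]
    (hR : ∀ e : R, e * e = e → e = 0 ∨ e = 1) (x : R) : IsUnit x ∨ IsNilpotent x := by
  obtain ⟨a, b, hab, h⟩ := Finite.exists_ne_map_eq_of_infinite (fun n : ℕ ↦ x ^ n)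
  rcases lt_or_gt_of_ne hab with hlt | hlt
  · exact isUnit_or_isNilpotent_of_pow_eq_pow hR hlt h
  · exact isUnit_or_isNilpotent_of_pow_eq_pow hR hlt h.symm

theorem finite_of_intCast_eq_zero {A : Type*} [CommRing A] [Module.Finite ℤ A] {n : ℤ}
    (hn : n ≠ 0) (h : (n : A) = 0) : Finite A := by
  refine Module.finite_of_fg_torsion A fun x ↦ ⟨⟨n, ?_⟩, ?_⟩
  · simpa using hn
  · simp [Submonoid.smul_def, ← Int.cast_smul_eq_zsmul A, h]

/-- If `x ^ 2 = 0`, then `a ↦ 1 + a * x` is a homomorphism from the additive group of the ring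
to its group of units. -/
def oneAddMulHom {R : Type*} [CommRing R] (x : R) (hx : x * x = 0) :
    Multiplicative R →* Rˣ where
  toFun a := ⟨1 + a.toAdd * x, 1 - a.toAdd * x,
    by linear_combination (-a.toAdd ^ 2) * hx, by linear_combination (-a.toAdd ^ 2) * hx⟩
  map_one' := by ext; simp
  map_mul' a b := by
    ext
    simp only [toAdd_mul, Units.val_mul]
    linear_combination (-a.toAdd * b.toAdd) * hx

theorem val_oneAddMulHom {R : Type*} [CommRing R] (x : R) (hx : x * x = 0) (a : R) :
    (oneAddMulHom x hx (.ofAdd a) : R) = 1 + a * x := rfl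

theorem oneAddMulHom_eq_one_iff {R : Type*} [CommRing R] (x : R) (hx : x * x = 0) (a : R) :
    oneAddMulHom x hx (.ofAdd a) = 1 ↔ a * x = 0 := by
  rw [← Units.val_inj, val_oneAddMulHom, Units.val_one, add_eq_left]

theorem exists_pow_ne_zero_of_isNilpotent {R : Type*} [CommRing R] {x : R} (hx : IsNilpotent x)
    (hx0 : x ≠ 0) : ∃ k, x ^ (k + 1) ≠ 0 ∧ x ^ (k + 2) = 0 := by
  classical
  have h0 : Nat.find hx ≠ 0 := fun h ↦ hx0 (by
    have := Nat.find_spec hx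
    rw [h, pow_zero] at this
    rw [← mul_one x, this, mul_zero])
  have h1 : Nat.find hx ≠ 1 := fun h ↦ hx0 (by simpa [h] using Nat.find_spec hx)
  obtain ⟨k, hk⟩ : ∃ k, Nat.find hx = k + 2 := ⟨Nat.find hx - 2, by omega⟩
  exact ⟨k, Nat.find_min hx (by omega), hk ▸ Nat.find_spec hx⟩

/-! ### Finite rings without nontrivial idempotents -/

theorem IsLocalRing.natCard_eq_units_add {R : Type*} [CommRing R] [IsLocalRing R] [Finite R] :
    Nat.card R = Nat.card Rˣ + Nat.card (IsLocalRing.maximalIdeal R) := by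
  classical
  rw [← Nat.card_congr (Equiv.sumCompl (fun x : R ↦ IsUnit x)), Nat.card_sum]
  congr 1
  exact (Nat.card_congr (Equiv.ofBijective (fun u : Rˣ ↦ (⟨u, u.isUnit⟩ : {x : R // IsUnit x}))
    ⟨fun u v h ↦ Units.ext (congrArg Subtype.val h), fun ⟨_, u, hu⟩ ↦ ⟨u, Subtype.ext hu⟩⟩)).symm

theorem natCard_eq_prime_of_isAddCyclic {A : Type*} [AddGroup A] [IsAddCyclic A] [Nontrivial A]
    {p : ℕ} (hp : p.Prime) (h : ∀ a : A, p • a = 0) : Nat.card A = p := by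
  obtain ⟨g, hg⟩ := IsAddCyclic.exists_ofOrder_eq_natCard (α := A)
  rw [← hg]
  have : Fact p.Prime := ⟨hp⟩
  refine addOrderOf_eq_prime (h g) fun h0 ↦ ?_
  rw [h0, addOrderOf_zero] at hg
  have := (Nat.card_eq_one_iff_unique.mp hg.symm).1
  exact not_subsingleton A this

section

variable {R : Type*} [CommRing R] [IsLocalRing R]

open IsLocalRing

/-- The last nonzero power of the maximal ideal is annihilated by the maximal ideal. -/
theorem exists_socle_element [Finite R] (hm : maximalIdeal R ≠ ⊥) :
    ∃ x ∈ maximalIdeal R, x ≠ 0 ∧ ∀ a ∈ maximalIdeal R, a * x = 0 := by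
  classical
  have hnil : IsNilpotent (maximalIdeal R) := by
    rw [← jacobson_eq_maximalIdeal ⊥ bot_ne_top]
    exact IsArtinianRing.isNilpotent_jacobson_bot
  have h0 : Nat.find hnil ≠ 0 := fun h ↦ by
    have := Nat.find_spec hnil
    rw [h, pow_zero, Ideal.zero_eq_bot, Ideal.one_eq_top] at this
    exact bot_ne_top this.symm
  have h1 : Nat.find hnil ≠ 1 := fun h ↦ hm (by simpa [h] using Nat.find_spec hnil)
  obtain ⟨k, hk⟩ : ∃ k, Nat.find hnil = k + 2 := ⟨Nat.find hnil - 2, by omega⟩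
  have hne : maximalIdeal R ^ (k + 1) ≠ ⊥ := Nat.find_min hnil (m := k + 1) (by omega)
  have hz : maximalIdeal R ^ (k + 2) = ⊥ := hk ▸ Nat.find_spec hnil
  obtain ⟨x, hx, hx0⟩ := Submodule.exists_mem_ne_zero_of_ne_bot hne
  refine ⟨x, Ideal.pow_le_self (by omega) hx, hx0, fun a ha ↦ ?_⟩
  have : a * x ∈ maximalIdeal R ^ (k + 2) := by
    rw [pow_succ' _ (k + 1)]
    exact Ideal.mul_mem_mul ha hx
  simpa [hz] using this

/-- For a socle element `x` the units `1 + a * x` form a copy of the additive group of the residue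
field, so this group is cyclic and the residue field is prime. -/
theorem natCard_residue_eq_prime [IsCyclic Rˣ] {p : ℕ} (hp : p.Prime)
    (hpm : (p : R) ∈ maximalIdeal R) {x : R} (hxm : x ∈ maximalIdeal R) (hx0 : x ≠ 0)
    (hx : ∀ a ∈ maximalIdeal R, a * x = 0) : Nat.card (R ⧸ maximalIdeal R) = p := by
  have hxx : x * x = 0 := hx x hxm
  let f : R →+ Additive Rˣ := (oneAddMulHom x hxx).toAdditiveRight
  have hker : f.ker = (maximalIdeal R).toAddSubgroup := by
    ext a
    rw [AddMonoidHom.mem_ker]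
    refine (oneAddMulHom_eq_one_iff x hxx a).trans ⟨fun h ↦ ?_, fun h ↦ hx a h⟩
    by_contra hu
    have hu : IsUnit a := by
      by_contra hn
      exact hu hn
    exact hx0 (hu.mul_right_eq_zero.mp h)
  have : IsAddCyclic (R ⧸ (maximalIdeal R).toAddSubgroup) := by
    rw [← hker]
    exact isAddCyclic_of_injective (QuotientAddGroup.kerLift f)
      (QuotientAddGroup.kerLift_injective f)
  have : IsAddCyclic (R ⧸ maximalIdeal R) := this
  refine natCard_eq_prime_of_isAddCyclic hp fun a ↦ ?_
  have hp0 : ((p : R ⧸ maximalIdeal R)) = 0 := by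
    rw [← map_natCast (Ideal.Quotient.mk (maximalIdeal R))]
    exact Ideal.Quotient.eq_zero_iff_mem.mpr hpm
  rw [nsmul_eq_mul, hp0, zero_mul]

theorem exists_natCard_maximalIdeal_eq_pow [Finite R] {p : ℕ} (hp : p.Prime)
    (hpn : IsNilpotent (p : R)) :
    ∃ s, Nat.card (maximalIdeal R) = p ^ s := by
  have : Fact p.Prime := ⟨hp⟩
  obtain ⟨j, hj⟩ := hpn
  have hP : IsPGroup p (Multiplicative (maximalIdeal R)) := fun a ↦ ⟨j, by
    apply Multiplicative.toAdd.injective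
    ext
    rw [toAdd_pow]
    simp [hj]⟩
  obtain ⟨n, hn⟩ := IsPGroup.iff_card.mp hP
  exact ⟨n, (Nat.card_congr Multiplicative.ofAdd).trans hn⟩

/-- If the residue field has two elements, then `2` lies in the socle: both `-1` and `1 + x`
square to `1`. Hence a unit `1 + t` has square `1 + t ^ 2`, and if `t ^ 4 ≠ 0`, the last two nonzero
powers of `t` give two different units of order `2`. -/
theorem natCard_units_dvd_four [Finite R] [IsCyclic Rˣ] (h2m : (2 : R) ∈ maximalIdeal R)
    (hnil : ∀ a ∈ maximalIdeal R, IsNilpotent a)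
    (hunit : ∀ u : Rˣ, (u : R) - 1 ∈ maximalIdeal R) {x : R} (hxm : x ∈ maximalIdeal R)
    (hx0 : x ≠ 0) (hx : ∀ a ∈ maximalIdeal R, a * x = 0) : Nat.card Rˣ ∣ 4 := by
  have key (a b : R) (ha : a * a = 0) (ha2 : 2 * a = 0) (ha0 : a ≠ 0) (hb : b * b = 0)
      (hb2 : 2 * b = 0) (hb0 : b ≠ 0) : b = a := by
    have hsq (c : R) (hc : c * c = 0) (hc2 : 2 * c = 0) :
        oneAddMulHom c hc (.ofAdd 1) ^ 2 = 1 := by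
      ext
      rw [Units.val_pow_eq_pow_val, val_oneAddMulHom, Units.val_one]
      linear_combination hc + hc2
    have hne (c : R) (hc : c * c = 0) (hc0 : c ≠ 0) : oneAddMulHom c hc (.ofAdd 1) ≠ 1 := by
      rwa [Ne, oneAddMulHom_eq_one_iff, one_mul]
    have h := IsCyclic.eq_of_sq_eq_one (hsq a ha ha2) (hne a ha ha0) (hsq b hb hb2) (hne b hb hb0)
    have h := congrArg (fun u : Rˣ ↦ (u : R)) h
    simpa [val_oneAddMulHom] using h
  have h2x : 2 * x = 0 := hx 2 h2m
  have h2 (a : R) (ha : a ∈ maximalIdeal R) : 2 * a = 0 := by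
    by_cases h1 : (-1 : Rˣ) = 1
    · have h1 : (-1 : R) = 1 := by simpa using congrArg (fun u : Rˣ ↦ (u : R)) h1
      linear_combination (-a) * h1
    · have h := IsCyclic.eq_of_sq_eq_one (a := oneAddMulHom x (hx x hxm) (.ofAdd 1)) (b := -1)
        (by ext; rw [Units.val_pow_eq_pow_val, val_oneAddMulHom, Units.val_one]
            linear_combination hx x hxm + h2x)
        (by rwa [Ne, oneAddMulHom_eq_one_iff, one_mul]) (by simp) h1
      have h : (-1 : R) = 1 + 1 * x := by
        simpa [val_oneAddMulHom] using congrArg (fun u : Rˣ ↦ (u : R)) h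
      linear_combination (-a) * h - hx a ha
  obtain ⟨g, hg⟩ := IsCyclic.exists_ofOrder_eq_natCard (α := Rˣ)
  rw [← hg]
  apply orderOf_dvd_of_pow_eq_one
  set t : R := g - 1 with ht
  have htm : t ∈ maximalIdeal R := hunit g
  have ht4 : t ^ 4 = 0 := by
    by_contra h4
    obtain ⟨k, hk1, hk2⟩ := exists_pow_ne_zero_of_isNilpotent (hnil t htm)
      (fun h ↦ h4 (by rw [h]; simp))
    have hk : 2 ≤ k := by
      by_contra hk
      exact h4 (pow_eq_zero_of_le (by omega) hk2)
    have hk0 : t ^ k ≠ 0 := fun h ↦ hk1 (by rw [pow_succ, h, zero_mul])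
    have htk (j : ℕ) (hj : j ≠ 0) : 2 * t ^ j = 0 :=
      h2 _ (Ideal.pow_mem_of_mem _ htm _ (Nat.pos_of_ne_zero hj))
    have heq := key (t ^ k) (t ^ (k + 1))
      (by rw [← pow_add]; exact pow_eq_zero_of_le (by omega) hk2) (htk _ (by omega)) hk0
      (by rw [← pow_add]; exact pow_eq_zero_of_le (by omega) hk2) (htk _ (by omega)) hk1
    exact hk1 (by rw [pow_succ, ← heq, ← pow_succ]; exact hk2)
  ext
  rw [Units.val_pow_eq_pow_val, Units.val_one, show (g : R) = 1 + t by rw [ht]; ring]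
  linear_combination ht4 + (2 + 3 * t + 2 * t ^ 2) * h2 t htm

end

/-- A connected finite ring is local. If it is not a field, its residue field is `𝔽_p`, so that
`|Rˣ| = (p - 1) * |m|` with `|m|` a power of `p`; for `p = 2` the order divides `4`. -/
theorem isListedOrder_natCard_units_of_finite {R : Type*} [CommRing R] [Nontrivial R] [Finite R]
    [IsCyclic Rˣ] (hR : ∀ e : R, e * e = e → e = 0 ∨ e = 1) : IsListedOrder (Nat.card Rˣ) := by
  have hdich := isUnit_or_isNilpotent_of_finite hR
  have : IsLocalRing R := IsLocalRing.of_isUnit_or_isUnit_one_sub_self fun a ↦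
    (hdich a).imp id fun h ↦ h.isUnit_one_sub
  let m := IsLocalRing.maximalIdeal R
  have hnil (a : R) (ha : a ∈ m) : IsNilpotent a := (hdich a).resolve_left ha
  let : Field (R ⧸ m) := Ideal.Quotient.field m
  have : Finite (R ⧸ m) := Finite.of_surjective _ Ideal.Quotient.mk_surjective
  have : Fintype (R ⧸ m) := Fintype.ofFinite _
  obtain ⟨p, hchar⟩ := CharP.exists (R ⧸ m)
  obtain ⟨r, hp, hq⟩ := FiniteField.card (R ⧸ m) p
  rw [← Nat.card_eq_fintype_card] at hq
  have hcard : Nat.card R = Nat.card (R ⧸ m) * Nat.card m :=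
    m.toAddSubgroup.card_eq_card_quotient_mul_card_addSubgroup
  rw [IsLocalRing.natCard_eq_units_add] at hcard
  change _ + Nat.card m = _ at hcard
  have hpm : (p : R) ∈ m := by
    rw [← Ideal.Quotient.eq_zero_iff_mem, map_natCast, CharP.cast_eq_zero]
  by_cases hm : m = ⊥
  · have h1 : Nat.card m = 1 := by rw [hm]; simp
    rw [h1, mul_one, hq] at hcard
    rw [show Nat.card Rˣ = p ^ (r : ℕ) - 1 by omega]
    exact .primePowSubOne p r hp r.pos
  obtain ⟨x, hxm, hx0, hx⟩ := exists_socle_element hm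
  have hqp : Nat.card (R ⧸ m) = p := natCard_residue_eq_prime hp hpm hxm hx0 hx
  obtain ⟨s, hs⟩ : ∃ s, Nat.card m = p ^ s := exists_natCard_maximalIdeal_eq_pow hp (hnil _ hpm)
  rw [hqp] at hcard
  rcases hp.two_le.eq_or_lt with rfl | hp2
  · have hunit (u : Rˣ) : (u : R) - 1 ∈ m := by
      rw [← Ideal.Quotient.eq_zero_iff_mem]
      have hu : Ideal.Quotient.mk m (u : R) ≠ 0 := (u.isUnit.map (Ideal.Quotient.mk m)).ne_zero
      obtain ⟨y, z, hyz, hall⟩ := Nat.card_eq_two_iff.mp hqp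
      have h01 : (0 : R ⧸ m) ≠ 1 := zero_ne_one
      have hmem (w : R ⧸ m) : w = y ∨ w = z := by
        have : w ∈ ({y, z} : Set (R ⧸ m)) := hall ▸ Set.mem_univ w
        simpa using this
      rw [map_sub, map_one, sub_eq_zero]
      rcases hmem 0, hmem 1, hmem (Ideal.Quotient.mk m (u : R)) with ⟨h0 | h0, h1 | h1, h2 | h2⟩ <;>
        simp_all
    have hdvd : Nat.card Rˣ ∣ 4 :=
      natCard_units_dvd_four (by exact_mod_cast hpm) hnil hunit hxm hx0 hx
    have hle := Nat.le_of_dvd (by norm_num) hdvd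
    generalize Nat.card Rˣ = N at hdvd hle
    interval_cases N
    · omega
    · exact .primePowSubOne 2 1 Nat.prime_two le_rfl
    · exact .primePowSubOne 3 1 Nat.prime_three le_rfl
    · omega
    · exact .primePowSubOne 5 1 Nat.prime_five le_rfl
  · have hs1 : 1 ≤ s := by
      by_contra h0
      obtain rfl : s = 0 := by omega
      rw [pow_zero] at hs
      have := (Nat.card_eq_one_iff_unique.mp hs).1
      exact hx0 (congrArg Subtype.val (Subsingleton.elim (⟨x, hxm⟩ : m) 0))
    rw [show Nat.card Rˣ = (p - 1) * p ^ s by rw [hs] at hcard; rw [Nat.sub_one_mul]; omega]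
    exact .predMulPow p s hp hp2 hs1

/-! ### Rings of characteristic zero with a unit of order divisible by four -/

/-- A complex `N`-th root of unity `z` with `(1 + z) ^ N = (1 - z) ^ N` is equidistant from `1`
and `-1`, hence equals `i` or `-i`. -/
theorem Complex.sq_eq_neg_one_of_one_add_pow_eq {N : ℕ} (hN : N ≠ 0) {z : ℂ} (hz : z ^ N = 1)
    (h : (1 + z) ^ N = (1 - z) ^ N) : z ^ 2 = -1 := by
  have hnorm : ‖1 + z‖ = ‖1 - z‖ := by
    have := congrArg norm h
    rw [norm_pow, norm_pow] at this
    exact (pow_left_inj₀ (norm_nonneg _) (norm_nonneg _) hN).mp this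
  have hz1 : ‖z‖ = 1 := Complex.norm_eq_one_of_pow_eq_one hz hN
  have h1 := congrArg (· ^ 2) hnorm
  simp only [Complex.sq_norm, Complex.normSq_apply, Complex.add_re, Complex.add_im, Complex.sub_re,
    Complex.sub_im, Complex.one_re, Complex.one_im] at h1
  have h2 := congrArg (· ^ 2) hz1
  simp only [Complex.sq_norm, Complex.normSq_apply] at h2
  have hre : z.re = 0 := by linarith
  rw [hre] at h2
  apply Complex.ext
  · simp [pow_two, hre]; linarith
  · simp [pow_two, hre]

open Polynomial in
/-- Over `ℚ` the separable polynomial `X ^ N - 1` and `(1 + X) ^ N - (1 - X) ^ N` have no common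
roots except `i` and `-i`, so some integer multiple of `X ^ 2 + 1` lies in the ideal that they
generate in `ℤ[X]`. -/
theorem exists_int_mul_sq_add_one_eq_zero {R : Type*} [CommRing R] {N : ℕ} (hN : N ≠ 0)
    (h4 : 4 ∣ N) {g : R} (hg : g ^ N = 1) (h : (1 + g) ^ N = (1 - g) ^ N) :
    ∃ n : ℤ, n ≠ 0 ∧ (n : R) * (g ^ 2 + 1) = 0 := by
  obtain ⟨P, hP⟩ : (X ^ 2 + 1 : ℤ[X]) ∣ X ^ N - 1 := by
    obtain ⟨k, rfl⟩ := h4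
    have h1 : (X ^ 2 + 1 : ℤ[X]) ∣ X ^ 4 - 1 := ⟨X ^ 2 - 1, by ring⟩
    have h2 := sub_dvd_pow_sub_pow (X ^ 4 : ℤ[X]) 1 k
    rw [one_pow, ← pow_mul] at h2
    exact h1.trans h2
  let Q : ℤ[X] := (1 + X) ^ N - (1 - X) ^ N
  have hcop : IsCoprime (P.map (Int.castRingHom ℚ)) (Q.map (Int.castRingHom ℚ)) := by
    rw [Polynomial.isCoprime_iff_aeval_ne_zero_of_isAlgClosed ℚ ℂ]
    intro z
    by_contra! hz
    obtain ⟨hzP, hzQ⟩ := hz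
    have hmap (F : ℤ[X]) : aeval z (F.map (Int.castRingHom ℚ)) = aeval z F := by
      rw [aeval_def, eval₂_map, aeval_def]
      congr 1
    rw [hmap] at hzP hzQ
    have hzN : z ^ N = 1 := by
      have := congrArg (aeval z) hP
      rw [map_mul, hzP, mul_zero] at this
      simpa [sub_eq_zero] using this
    have hz2 : z ^ 2 = -1 := Complex.sq_eq_neg_one_of_one_add_pow_eq hN hzN
      (by simpa [Q, sub_eq_zero] using hzQ)
    have hsep : (X ^ N - 1 : ℂ[X]).Separable :=
      X_pow_sub_one_separable_iff.mpr (by exact_mod_cast hN)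
    have hPC := congrArg (Polynomial.map (Int.castRingHom ℂ)) hP
    rw [Polynomial.map_mul] at hPC
    have hPC' : (X ^ N - 1 : ℂ[X]) =
        (X ^ 2 + 1 : ℤ[X]).map (Int.castRingHom ℂ) * P.map (Int.castRingHom ℂ) := by
      rw [← hPC]
      simp
    rw [hPC'] at hsep
    obtain ⟨a, b, hab⟩ := hsep.isCoprime
    have hPz : (P.map (Int.castRingHom ℂ)).eval z = 0 := by
      rw [eval_map, ← hzP, aeval_def]
      congr 1
    have := congrArg (eval z) hab
    simp [hPz, hz2] at this
  obtain ⟨a, b, hab⟩ := hcop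
  obtain ⟨m, hm, hma⟩ := IsLocalization.integerNormalization_spec (nonZeroDivisors ℤ) a
  obtain ⟨n, hn, hnb⟩ := IsLocalization.integerNormalization_spec (nonZeroDivisors ℤ) b
  -- Clearing denominators in the Bézout identity for `P` and `Q` over `ℚ`.
  let a' := IsLocalization.integerNormalization (nonZeroDivisors ℤ) a
  let b' := IsLocalization.integerNormalization (nonZeroDivisors ℤ) b
  have hZ : n * a' * P + m * b' * Q = (m * n : ℤ[X]) := by
    apply Polynomial.map_injective (Int.castRingHom ℚ) Int.cast_injective
    have hma : a'.map (Int.castRingHom ℚ) = m * a := by rw [← zsmul_eq_mul]; exact hma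
    have hnb : b'.map (Int.castRingHom ℚ) = n * b := by rw [← zsmul_eq_mul]; exact hnb
    simp only [Polynomial.map_add, Polynomial.map_mul, Polynomial.map_intCast, hma, hnb]
    linear_combination (m : ℚ[X]) * n * hab
  refine ⟨m * n, mul_ne_zero (nonZeroDivisors.ne_zero hm) (nonZeroDivisors.ne_zero hn), ?_⟩
  have hPg : (g ^ 2 + 1) * aeval g P = 0 := by
    have := congrArg (aeval g) hP
    rw [map_mul] at this
    simpa [hg] using this.symm
  have hQg : aeval g Q = 0 := by simp [Q, h]
  have hZg := congrArg (aeval g) hZ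
  simp only [map_add, map_mul, map_intCast, hQg, mul_zero, add_zero] at hZg
  push_cast
  linear_combination (n : R) * aeval g a' * hPg - (g ^ 2 + 1) * hZg

theorem one_add_mul_sub_one_mul_one_sub_mul_sub_one {R : Type*} [CommRing R] {g E : R}
    (h : (1 - g ^ 2) * E = 2) :
    ((1 + g) * E - 1) * ((1 - g) * E - 1) = 1 := by
  linear_combination E * h

/-- With `E` the sum of the `g ^ (2 * j)` for `j < M`, the cyclotomic unit `u = (1 + g) * E - 1`
satisfies `1 + g = (1 - g) * u`; like every unit it has order dividing `|Rˣ|`. -/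
theorem one_add_pow_eq_one_sub_pow {R : Type*} [CommRing R] [Finite Rˣ] {g : R} {M : ℕ}
    (hg : g ^ (2 * M) = -1) : (1 + g) ^ Nat.card Rˣ = (1 - g) ^ Nat.card Rˣ := by
  let E : R := ∑ j ∈ Finset.range M, (g ^ 2) ^ j
  have hE : (1 - g ^ 2) * E = 2 := by
    rw [mul_neg_geom_sum, ← pow_mul, hg]
    norm_num
  let u : Rˣ := Units.mkOfMulEqOne _ _ (one_add_mul_sub_one_mul_one_sub_mul_sub_one hE)
  have hu : (u : R) = (1 + g) * E - 1 := rfl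
  have hpow : (u : R) ^ Nat.card Rˣ = 1 := by
    rw [← Units.val_pow_eq_pow_val, pow_card_eq_one', Units.val_one]
  have h : 1 + g = (1 - g) * u := by
    rw [hu]
    linear_combination -hE
  rw [h, mul_pow, hpow, mul_one]

/-- A unit `1 + x` of odd prime order `q` with `x` nilpotent gives an element `y` of additive order
`q` and square zero. If `i ^ 2 = -1`, then `1 + i * y` is a power of `1 + y`, so `i` acts on
`y` as an integer, which is a square root of `-1` modulo `q`. -/
theorem mod_four_eq_one_of_isNilpotent {R : Type*} [CommRing R] [Finite Rˣ] [IsCyclic Rˣ]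
    {q : ℕ} (hq : q.Prime) (hq2 : q ≠ 2) {i x : R} (hi : i ^ 2 = -1) (hx : IsNilpotent x)
    (hx0 : x ≠ 0) (hxq : (1 + x) ^ q = 1) : q % 4 = 1 := by
  have : Fact q.Prime := ⟨hq⟩
  obtain ⟨k, hk1, hk2⟩ := exists_pow_ne_zero_of_isNilpotent hx hx0
  obtain ⟨y, hy⟩ : ∃ y, y = x ^ (k + 1) := ⟨_, rfl⟩
  have hyx : y * x = 0 := by rw [hy, ← pow_succ]; exact hk2
  have hyy : y * y = 0 := by
    nth_rw 2 [hy]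
    rw [pow_succ', ← mul_assoc, hyx, zero_mul]
  have hqy : (q : R) * y = 0 := by
    obtain ⟨c, hc⟩ : ∃ c, (1 + x) ^ q = 1 + q * x + c * x ^ 2 := by
      obtain ⟨c, hc⟩ := Polynomial.binomExpansion (Polynomial.X ^ q : Polynomial R) 1 x
      exact ⟨c, by simpa [Polynomial.derivative_X_pow] using hc⟩
    have h1 : q * x = -(c * x ^ 2) := by linear_combination hxq - hc
    have h2 : x ^ k * x ^ 2 = 0 := by rw [← pow_add]; exact hk2
    rw [hy, pow_succ]
    linear_combination x ^ k * h1 - c * h2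
  let f := oneAddMulHom y hyy
  have hfq (a : R) : f (.ofAdd a) ^ q = 1 := by
    rw [← map_pow, ← ofAdd_nsmul, nsmul_eq_mul]
    exact (oneAddMulHom_eq_one_iff y hyy _).mpr (by linear_combination a * hqy)
  have hf1 : f (.ofAdd 1) ≠ 1 := by
    rw [Ne, oneAddMulHom_eq_one_iff, one_mul, hy]
    exact hk1
  obtain ⟨c, hc⟩ := IsCyclic.mem_zpowers_of_pow_prime_eq_one hq (hfq 1) hf1 (hfq i)
  have hc' : (c : R) * y = i * y := by
    have h1 : f (.ofAdd (c : R)) = f (.ofAdd i) := by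
      rw [← hc]
      simp only
      rw [← map_zpow, ← ofAdd_zsmul, zsmul_one]
    have h2 := congrArg (fun u : Rˣ ↦ (u : R)) h1
    simpa [f, val_oneAddMulHom] using h2
  have hsq : ((c ^ 2 + 1 : ℤ) : R) * y = 0 := by
    push_cast
    linear_combination (c + i) * hc' + y * hi
  have hdvd : (q : ℤ) ∣ c ^ 2 + 1 := by
    by_contra hnd
    obtain ⟨a, b, hab⟩ := ((Nat.prime_iff_prime_int.mp hq).coprime_iff_not_dvd).mpr hnd
    apply hk1
    rw [← hy]
    have hab : (a : R) * q + b * ((c ^ 2 + 1 : ℤ) : R) = 1 := by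
      simpa using congrArg (Int.cast : ℤ → R) hab
    linear_combination (-y) * hab + a * hqy + b * hsq
  have h3 : q % 4 ≠ 3 := by
    rw [← ZMod.exists_sq_eq_neg_one_iff]
    refine ⟨c, ?_⟩
    have := (ZMod.intCast_zmod_eq_zero_iff_dvd _ q).mpr hdvd
    push_cast at this
    linear_combination -this
  have := hq.eq_two_or_odd.resolve_left hq2
  omega

/-- If `n * x = 0`, then the powers of `x` are eventually periodic, because they are so in the
finite ring `R ⧸ (n)` and `x` annihilates the ideal `(n)`. In characteristic zero `x` is not a
unit. -/
theorem isNilpotent_of_torsion {R : Type*} [CommRing R] [CharZero R] [Module.Finite ℤ R]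
    (hR : ∀ e : R, e * e = e → e = 0 ∨ e = 1) {x : R} {n : ℤ}
    (hn : n ≠ 0) (hx : (n : R) * x = 0) : IsNilpotent x := by
  let I : Ideal R := Ideal.span {(n : R)}
  have : Module.Finite ℤ (R ⧸ I) := Module.Finite.of_surjective
    ((Ideal.Quotient.mk I).toAddMonoidHom.toIntLinearMap) Ideal.Quotient.mk_surjective
  have : Finite (R ⧸ I) := finite_of_intCast_eq_zero hn (by
    rw [← map_intCast (Ideal.Quotient.mk I), Ideal.Quotient.eq_zero_iff_mem]
    exact Ideal.mem_span_singleton_self _)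
  obtain ⟨a, b, hab, h⟩ := Finite.exists_ne_map_eq_of_infinite
    (fun k : ℕ ↦ Ideal.Quotient.mk I (x ^ k))
  obtain ⟨r, hr⟩ := Ideal.mem_span_singleton'.mp (Ideal.Quotient.eq.mp h)
  have h' : x ^ (a + 1) = x ^ (b + 1) := by
    rw [pow_succ, pow_succ]
    linear_combination r * hx - x * hr
  have hdich : IsUnit x ∨ IsNilpotent x := by
    rcases lt_or_gt_of_ne hab with hlt | hlt
    · exact isUnit_or_isNilpotent_of_pow_eq_pow hR (by omega) h'
    · exact isUnit_or_isNilpotent_of_pow_eq_pow hR (by omega) h'.symm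
  refine hdich.resolve_left fun hu ↦ hn ?_
  exact_mod_cast hu.mul_left_eq_zero.mp hx

/-- The order of the units is even because `-1 ≠ 1`, and the case of `2` times an odd number is
listed. If the order of a generator `g` is `4 * d`, then `g ^ 2 + 1` is torsion. Therefore
`g ^ (4 * k) - 1` is torsion, hence nilpotent, for all `k`. For even `d` this contradicts
`g ^ (2 * d) = -1`, and for a prime factor `q` of `d` it applies to the units of order `q`. -/
theorem isListedOrder_natCard_units_of_charZero {R : Type*} [CommRing R] [CharZero R]
    [Module.Finite ℤ R] [Finite Rˣ] [IsCyclic Rˣ] (hR : ∀ e : R, e * e = e → e = 0 ∨ e = 1) :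
    IsListedOrder (Nat.card Rˣ) := by
  have hneg : (-1 : Rˣ) ≠ 1 := fun h ↦ by
    have h1 : (-1 : R) = 1 := by simpa using congrArg (fun u : Rˣ ↦ (u : R)) h
    have h2 : (2 : R) = 0 := by linear_combination -h1
    exact two_ne_zero h2
  have h2 : 2 ∣ Nat.card Rˣ := by
    rw [← orderOf_eq_prime (p := 2) (x := (-1 : Rˣ)) (by simp) hneg]
    exact orderOf_dvd_natCard _
  obtain ⟨N', hN'⟩ := h2
  rcases Nat.even_or_odd' N' with ⟨d, rfl | rfl⟩
  swap
  · rw [hN']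
    exact .twoMul _ ⟨d, rfl⟩
  have hN : Nat.card Rˣ = 4 * d := by omega
  have hpos : 0 < Nat.card Rˣ := Nat.card_pos
  obtain ⟨g, hg⟩ := IsCyclic.exists_ofOrder_eq_natCard (α := Rˣ)
  rw [hN] at hg hpos
  have hg1 : g ^ (4 * d) = 1 := hg ▸ pow_orderOf_eq_one g
  have hghalf : g ^ (2 * d) = -1 := by
    symm
    refine IsCyclic.eq_of_sq_eq_one ?_ ?_ (by simp) hneg
    · rw [← pow_mul, ← hg1]; congr 1; omega
    · exact pow_ne_one_of_lt_orderOf (by omega) (by omega)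
  have hghalf' : (g : R) ^ (2 * d) = -1 := by
    simpa using congrArg (fun u : Rˣ ↦ (u : R)) hghalf
  obtain ⟨n, hn0, hn⟩ := exists_int_mul_sq_add_one_eq_zero (g := (g : R)) (N := 4 * d) (by omega)
    ⟨d, rfl⟩ (by rw [← Units.val_pow_eq_pow_val, hg1, Units.val_one])
    (hN ▸ one_add_pow_eq_one_sub_pow hghalf')
  have htors (k : ℕ) : (n : R) * ((g : R) ^ (4 * k) - 1) = 0 := by
    obtain ⟨c, hc⟩ := sub_dvd_pow_sub_pow ((g : R) ^ 4) 1 k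
    rw [one_pow, ← pow_mul] at hc
    rw [hc]
    linear_combination ((g : R) ^ 2 - 1) * c * hn
  have hodd : Odd d := by
    rw [← Nat.not_even_iff_odd]
    rintro ⟨k, rfl⟩
    have h := htors k
    rw [show 4 * k = 2 * (k + k) by ring, hghalf'] at h
    have h : ((-2 * n : ℤ) : R) = 0 := by push_cast; linear_combination h
    rw [Int.cast_eq_zero] at h
    omega
  rw [hN]
  refine .fourMul d hodd fun q hq ⟨c, hc⟩ ↦ ?_
  have hq2 : q ≠ 2 := by
    rintro rfl
    rw [← Nat.not_even_iff_odd] at hodd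
    exact hodd ⟨c, by omega⟩
  have hc0 : 0 < c := by
    rcases Nat.eq_zero_or_pos c with rfl | h
    · omega
    · exact h
  refine mod_four_eq_one_of_isNilpotent hq hq2 (i := (g : R) ^ d) (x := (g : R) ^ (4 * c) - 1)
    (by rw [← pow_mul, mul_comm, hghalf']) (isNilpotent_of_torsion hR hn0 (htors c))
    ?_ ?_
  · rw [sub_ne_zero]
    intro h
    refine pow_ne_one_of_lt_orderOf (x := g) (n := 4 * c) (by omega) ?_
      (Units.ext (by simpa using h))
    rw [hg, hc]
    nlinarith [hq.two_le]
  · rw [add_sub_cancel, ← pow_mul, ← Units.val_pow_eq_pow_val,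
      show 4 * c * q = 4 * d by rw [hc]; ring, hg1, Units.val_one]

/-! ### Splitting a ring into connected factors -/

/-- The natural numbers that are products of finite sets of pairwise coprime listed orders. -/
def IsCoprimeProductOfListedOrders (N : ℕ) : Prop :=
  ∃ s : Finset ℕ, (∀ n ∈ s, IsListedOrder n) ∧
    (∀ m ∈ s, ∀ n ∈ s, m ≠ n → Nat.Coprime m n) ∧ N = ∏ n ∈ s, n

theorem IsListedOrder.isCoprimeProduct {N : ℕ} (h : IsListedOrder N) :
    IsCoprimeProductOfListedOrders N :=
  ⟨{N}, by simpa using h, by simp, by simp⟩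

theorem IsCoprimeProductOfListedOrders.mul {M N : ℕ}
    (hM : IsCoprimeProductOfListedOrders M) (hN : IsCoprimeProductOfListedOrders N)
    (h : M.Coprime N) :
    IsCoprimeProductOfListedOrders (M * N) := by
  obtain ⟨s, hs, hsc, rfl⟩ := hM
  obtain ⟨t, ht, htc, rfl⟩ := hN
  have hst (m : ℕ) (hm : m ∈ s) (n : ℕ) (hn : n ∈ t) : m.Coprime n :=
    h.coprime_dvd_left (Finset.dvd_prod_of_mem _ hm) |>.coprime_dvd_right
      (Finset.dvd_prod_of_mem _ hn)
  -- The two sets may share only the element `1`, which does not contribute to the products.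
  refine ⟨s ∪ t, ?_, ?_, ?_⟩
  · intro n hn
    exact (Finset.mem_union.mp hn).elim (hs n) (ht n)
  · intro m hm n hn hmn
    rcases Finset.mem_union.mp hm with hm | hm <;> rcases Finset.mem_union.mp hn with hn | hn
    · exact hsc m hm n hn hmn
    · exact hst m hm n hn
    · exact (hst n hn m hm).symm
    · exact htc m hm n hn hmn
  · rw [← Finset.prod_union_inter, Finset.prod_eq_one (s := s ∩ t), mul_one]
    intro n hn
    rw [Finset.mem_inter] at hn
    exact (Nat.coprime_self n).mp (hst n hn.1 n hn.2)

/-- A connected ring that is finitely generated over `ℤ` is finite or of characteristic zero. -/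
theorem isListedOrder_natCard_units {R : Type*} [CommRing R] [Module.Finite ℤ R] [Finite Rˣ]
    [IsCyclic Rˣ] (hR : ∀ e : R, e * e = e → e = 0 ∨ e = 1) : IsListedOrder (Nat.card Rˣ) := by
  rcases subsingleton_or_nontrivial R with _ | _
  · rw [Nat.card_unique]
    exact .primePowSubOne 2 1 Nat.prime_two le_rfl
  obtain ⟨n, hn⟩ := CharP.exists R
  rcases eq_or_ne n 0 with rfl | hn0
  · have : CharZero R := CharP.charP_to_charZero R
    exact isListedOrder_natCard_units_of_charZero hR
  · have : Finite R := finite_of_intCast_eq_zero (n := n) (by exact_mod_cast hn0) (by simp)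
    exact isListedOrder_natCard_units_of_finite hR

/-- Noetherian induction on the ideal: a nontrivial idempotent of `R ⧸ I` splits this ring into two
proper quotients, and the factors of a finite cyclic product have coprime orders. -/
theorem isCoprimeProduct_natCard_units_quotient {R : Type*} [CommRing R] [Module.Finite ℤ R]
    (I : Ideal R) (hfin : Finite (R ⧸ I)ˣ) (hcyc : IsCyclic (R ⧸ I)ˣ) :
    IsCoprimeProductOfListedOrders (Nat.card (R ⧸ I)ˣ) := by
  have : IsNoetherianRing R := isNoetherian_of_isNoetherianRing_of_finite ℤ R |> fun h ↦
    isNoetherian_of_tower ℤ h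
  induction I using IsNoetherian.induction with | hgt I ih =>
  have hmod : Module.Finite ℤ (R ⧸ I) := Module.Finite.of_surjective
    ((Ideal.Quotient.mk I).toAddMonoidHom.toIntLinearMap) Ideal.Quotient.mk_surjective
  by_cases hI : ∀ e : R ⧸ I, e * e = e → e = 0 ∨ e = 1
  · exact (isListedOrder_natCard_units hI).isCoprimeProduct
  push Not at hI
  obtain ⟨e, he, he0, he1⟩ := hI
  obtain ⟨a, rfl⟩ := Ideal.Quotient.mk_surjective e
  have haI : a * (1 - a) ∈ I := by
    rw [← Ideal.Quotient.eq_zero_iff_mem]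
    simp only [map_mul, map_sub, map_one]
    linear_combination -he
  let J := I ⊔ Ideal.span {a}
  let K := I ⊔ Ideal.span {1 - a}
  have haJ : a ∈ J := Ideal.mem_sup_right (Ideal.mem_span_singleton_self a)
  have haK : 1 - a ∈ K := Ideal.mem_sup_right (Ideal.mem_span_singleton_self (1 - a))
  have hIJ : I < J := lt_of_le_of_ne le_sup_left fun h ↦
    he0 (Ideal.Quotient.eq_zero_iff_mem.mpr (h ▸ haJ))
  have hIK : I < K := lt_of_le_of_ne le_sup_left fun h ↦ he1 (by
    have := Ideal.Quotient.eq_zero_iff_mem.mpr (show 1 - a ∈ I from h ▸ haK)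
    rw [map_sub, map_one, sub_eq_zero] at this
    exact this.symm)
  have hcop : IsCoprime J K := Ideal.isCoprime_iff_exists.mpr ⟨a, haJ, 1 - a, haK, by ring⟩
  have hinf : I = J ⊓ K := by
    refine le_antisymm (le_inf le_sup_left le_sup_left) fun x ⟨hxJ, hxK⟩ ↦ ?_
    obtain ⟨i, hi, y, hy, hxy⟩ := Submodule.mem_sup.mp hxJ
    obtain ⟨j, hj, z, hz, hxz⟩ := Submodule.mem_sup.mp hxK
    obtain ⟨r, rfl⟩ := Ideal.mem_span_singleton'.mp hy
    obtain ⟨t, rfl⟩ := Ideal.mem_span_singleton'.mp hz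
    have : x = (1 - a) * i + a * j + (r + t) * (a * (1 - a)) := by
      linear_combination (-(1 - a)) * hxy - a * hxz
    rw [this]
    exact I.add_mem (I.add_mem (Ideal.mul_mem_left I _ hi) (Ideal.mul_mem_left I _ hj))
      (Ideal.mul_mem_left I _ haI)
  let φ : (R ⧸ I)ˣ ≃* (R ⧸ J)ˣ × (R ⧸ K)ˣ :=
    (Units.mapEquiv ((Ideal.quotEquivOfEq hinf).trans
      (Ideal.quotientInfEquivQuotientProd J K hcop)).toMulEquiv).trans MulEquiv.prodUnits
  have hprod : IsCyclic ((R ⧸ J)ˣ × (R ⧸ K)ˣ) := φ.isCyclic.mp hcyc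
  obtain ⟨hcJ, hcK, hcard⟩ := Group.isCyclic_prod_iff.mp hprod
  have hfJ : Finite (R ⧸ J)ˣ := Finite.of_surjective _ (Prod.fst_surjective.comp φ.surjective)
  have hfK : Finite (R ⧸ K)ˣ := Finite.of_surjective _ (Prod.snd_surjective.comp φ.surjective)
  rw [Nat.card_congr φ.toEquiv, Nat.card_prod]
  exact (ih J hIJ hfJ hcJ).mul (ih K hIK hfK hcK) hcard

theorem isCoprimeProduct_natCard_units (R : Type*) [CommRing R] [Finite Rˣ] [IsCyclic Rˣ] :
    IsCoprimeProductOfListedOrders (Nat.card Rˣ) := by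
  -- The subring generated by the units has the same units.
  let S : Subalgebra ℤ R := Algebra.adjoin ℤ (Set.range ((↑) : Rˣ → R))
  have hmem (u : Rˣ) : (u : R) ∈ S := Algebra.subset_adjoin ⟨u, rfl⟩
  have hS : Module.Finite ℤ S := by
    refine Module.Finite.iff_fg.mpr (fg_adjoin_of_finite (Set.finite_range _) ?_)
    rintro _ ⟨u, rfl⟩
    refine IsIntegral.of_pow (n := Nat.card Rˣ) Nat.card_pos ?_
    rw [← Units.val_pow_eq_pow_val, pow_card_eq_one', Units.val_one]
    exact isIntegral_one
  let φ : Sˣ ≃* Rˣ := MulEquiv.ofBijective (Units.map (S.val : S →* R))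
    ⟨Units.map_injective Subtype.val_injective, fun u ↦
      ⟨⟨⟨u, hmem u⟩, ⟨(u⁻¹ : Rˣ), hmem _⟩, Subtype.ext (by simp), Subtype.ext (by simp)⟩,
        Units.ext rfl⟩⟩
  let ψ : (S ⧸ (⊥ : Ideal S))ˣ ≃* Rˣ :=
    (Units.mapEquiv (RingEquiv.quotientBot S).toMulEquiv).trans φ
  rw [← Nat.card_congr ψ.toEquiv]
  exact isCoprimeProduct_natCard_units_quotient ⊥ (Finite.of_equiv _ ψ.symm.toEquiv)
    (ψ.isCyclic.mpr inferInstance)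

/-! ### Construction of the rings -/

/-- The group of units of a square-zero extension `R ⊕ M` is `Rˣ × M`. -/
noncomputable def TrivSqZeroExt.unitsEquiv (R M : Type*) [CommRing R] [AddCommGroup M] [Module R M]
    [Module Rᵐᵒᵖ M] [IsCentralScalar R M] : Rˣ × Multiplicative M ≃* (TrivSqZeroExt R M)ˣ :=
  MulEquiv.ofBijective
    (MonoidHom.coprod
      (Units.map (TrivSqZeroExt.inlHom R M : R →* TrivSqZeroExt R M))
      { toFun := fun m ↦ ⟨1 + .inr m.toAdd, 1 - .inr m.toAdd, by ext <;> simp, by ext <;> simp⟩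
        map_one' := by ext <;> simp
        map_mul' := fun a b ↦ by ext <;> simp [add_comm] })
    ⟨by
      rintro ⟨u, m⟩ ⟨v, n⟩ h
      have h1 := congrArg (fun w : (TrivSqZeroExt R M)ˣ ↦ (w : TrivSqZeroExt R M).fst) h
      have h2 := congrArg (fun w : (TrivSqZeroExt R M)ˣ ↦ (w : TrivSqZeroExt R M).snd) h
      simp at h1 h2
      obtain rfl : u = v := Units.ext h1
      have h3 := congrArg (fun x ↦ (u⁻¹ : Rˣ).val • x) h2
      simpa [smul_smul] using h3,
    fun w ↦ by
      -- The unit `u + m` is `u * (1 + u⁻¹ • m)`.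
      let u : Rˣ := Units.map (TrivSqZeroExt.fstHom R R M : TrivSqZeroExt R M →* R) w
      refine ⟨(u, .ofAdd ((u⁻¹ : Rˣ).val • (w : TrivSqZeroExt R M).snd)), ?_⟩
      have hu : (u : R) = (w : TrivSqZeroExt R M).fst := rfl
      ext
      · simp [hu]
      · simp [smul_smul]⟩

/-- There is a commutative ring whose group of units is cyclic of order `N`. Rings in the lowest
universe suffice, as they can be lifted. -/
def IsCyclicUnitsOrder (N : ℕ) : Prop :=
  ∃ (R : Type) (_ : CommRing R), IsCyclic Rˣ ∧ Nat.card Rˣ = N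

theorem IsCyclicUnitsOrder.mul {M N : ℕ} (hM : IsCyclicUnitsOrder M) (hN : IsCyclicUnitsOrder N)
    (h : M.Coprime N) : IsCyclicUnitsOrder (M * N) := by
  obtain ⟨R, _, hR, rfl⟩ := hM
  obtain ⟨S, _, hS, rfl⟩ := hN
  refine ⟨R × S, inferInstance, ?_, ?_⟩
  · exact (MulEquiv.prodUnits (M := R) (N := S)).isCyclic.mpr
      (Group.isCyclic_prod_iff.mpr ⟨hR, hS, h⟩)
  · rw [Nat.card_congr (MulEquiv.prodUnits (M := R) (N := S)).toEquiv, Nat.card_prod]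

/-- If `d` is coprime to the order of the cyclic group `Rˣ` and `ℤ/d` is an `R`-module, then the
square-zero extension `R ⊕ ℤ/d` has a cyclic group of units of order `|Rˣ| * d`. -/
theorem isCyclicUnitsOrder_mul_of_module {R : Type} [CommRing R] [IsCyclic Rˣ] {d : ℕ}
    [Module R (ZMod d)] (h : (Nat.card Rˣ).Coprime d) : IsCyclicUnitsOrder (Nat.card Rˣ * d) := by
  let : Module Rᵐᵒᵖ (ZMod d) :=
    Module.compHom _ ((RingHom.id R).fromOpposite fun _ _ ↦ mul_comm _ _)
  have : IsCentralScalar R (ZMod d) := ⟨fun _ _ ↦ rfl⟩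
  have hcard : Nat.card (Multiplicative (ZMod d)) = d := Nat.card_zmod d
  refine ⟨TrivSqZeroExt R (ZMod d), inferInstance, ?_, ?_⟩
  · refine (TrivSqZeroExt.unitsEquiv R (ZMod d)).isCyclic.mp
      (Group.isCyclic_prod_iff.mpr ⟨inferInstance, inferInstance, ?_⟩)
    rwa [hcard]
  · rw [← Nat.card_congr (TrivSqZeroExt.unitsEquiv R (ZMod d)).toEquiv, Nat.card_prod, hcard]

/-- A square root `r` of `-1` modulo `p` gives the square root `r ^ p ^ k` modulo `p ^ (k + 1)`. -/
theorem isSquare_neg_one_zmod_prime_pow {p : ℕ} (hp : p.Prime) (h : p % 4 = 1) (k : ℕ) :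
    IsSquare (-1 : ZMod (p ^ (k + 1))) := by
  have : Fact p.Prime := ⟨hp⟩
  obtain ⟨y, hy⟩ := ZMod.exists_sq_eq_neg_one_iff (p := p).mpr (by omega)
  obtain ⟨r, rfl⟩ := ZMod.intCast_surjective y
  have h1 : (p : ℤ) ∣ r * r - (-1) := by
    rw [← ZMod.intCast_zmod_eq_zero_iff_dvd]
    push_cast
    rw [← hy]
    ring
  have h2 := dvd_sub_pow_of_dvd_sub (R := ℤ) (p := p) h1 k
  have hodd : Odd (p ^ k) := (Nat.odd_iff.mpr (by omega)).pow
  rw [hodd.neg_one_pow] at h2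
  refine ⟨(r : ZMod _) ^ p ^ k, ?_⟩
  have h3 := (ZMod.intCast_zmod_eq_zero_iff_dvd ((r * r) ^ p ^ k - -1) (p ^ (k + 1))).mpr
    (by exact_mod_cast h2)
  push_cast at h3
  rw [← mul_pow]
  linear_combination -h3

theorem isSquare_neg_one_zmod {d : ℕ} (hd : d ≠ 0) (h : ∀ q : ℕ, q.Prime → q ∣ d → q % 4 = 1) :
    IsSquare (-1 : ZMod d) := by
  induction d using Nat.recOnPrimeCoprime with
  | zero => exact absurd rfl hd
  | prime_pow p n hp =>
    cases n with
    | zero => exact ⟨0, Subsingleton.elim (α := ZMod 1) _ _⟩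
    | succ k => exact isSquare_neg_one_zmod_prime_pow hp (h p hp (dvd_pow_self p (by omega))) k
  | coprime a b ha hb hab iha ihb =>
    exact ZMod.isSquare_neg_one_mul hab
      (iha (by omega) fun q hq hqa ↦ h q hq (hqa.mul_right b))
      (ihb (by omega) fun q hq hqb ↦ h q hq (hqb.mul_left a))

theorem GaussianInt.mem_zpowers_unit {i : GaussianIntˣ} (hi : (i : GaussianInt) = ⟨0, 1⟩)
    (u : GaussianIntˣ) : u ∈ Subgroup.zpowers i := by
  have hn := (Zsqrtd.norm_eq_one_iff' (by norm_num) (u : GaussianInt)).mpr u.isUnit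
  rw [Zsqrtd.norm_def] at hn
  have hcases : (u : GaussianInt) = ⟨0, 1⟩ ^ 0 ∨ (u : GaussianInt) = ⟨0, 1⟩ ^ 1 ∨
      (u : GaussianInt) = ⟨0, 1⟩ ^ 2 ∨ (u : GaussianInt) = ⟨0, 1⟩ ^ 3 := by
    generalize (u : GaussianInt) = z at hn
    obtain ⟨a, b⟩ := z
    simp only at hn
    have ha : a ≤ 1 := by nlinarith [mul_self_nonneg b]
    have ha' : -1 ≤ a := by nlinarith [mul_self_nonneg b]
    have hb : b ≤ 1 := by nlinarith [mul_self_nonneg a]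
    have hb' : -1 ≤ b := by nlinarith [mul_self_nonneg a]
    interval_cases a <;> interval_cases b <;> first | omega | decide
  have key (k : ℕ) (h : (u : GaussianInt) = ⟨0, 1⟩ ^ k) : u ∈ Subgroup.zpowers i := by
    rw [← hi, ← Units.val_pow_eq_pow_val] at h
    rw [Units.ext h]
    exact Subgroup.npow_mem_zpowers i k
  rcases hcases with h | h | h | h <;> exact key _ h

theorem GaussianInt.isCyclic_units_and_natCard :
    IsCyclic GaussianIntˣ ∧ Nat.card GaussianIntˣ = 4 := by
  let i : GaussianIntˣ := ⟨⟨0, 1⟩, ⟨0, -1⟩, by decide, by decide⟩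
  have hi := GaussianInt.mem_zpowers_unit (i := i) rfl
  refine ⟨⟨i, hi⟩, ?_⟩
  rw [← orderOf_eq_card_of_forall_mem_zpowers hi]
  exact orderOf_eq_prime_pow (p := 2) (n := 1) (x := i)
    (fun h ↦ absurd (congrArg Units.val h) (by decide)) (Units.ext (by decide))

theorem IsListedOrder.isCyclicUnitsOrder {N : ℕ} (h : IsListedOrder N) : IsCyclicUnitsOrder N := by
  cases h with
  | primePowSubOne p l hp hl =>
    have : Fact p.Prime := ⟨hp⟩
    refine ⟨GaloisField p l, inferInstance, inferInstance, ?_⟩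
    rw [Nat.card_units, GaloisField.card p l (by omega)]
  | predMulPow p k hp hp2 hk =>
    have : NeZero (p ^ (k + 1)) := ⟨pow_ne_zero _ hp.ne_zero⟩
    refine ⟨ZMod (p ^ (k + 1)), inferInstance,
      ZMod.isCyclic_units_of_prime_pow p hp hp2.ne' (k + 1), ?_⟩
    rw [Nat.card_eq_fintype_card, ZMod.card_units_eq_totient, Nat.totient_prime_pow_succ hp,
      mul_comm]
  | twoMul d hd =>
    -- The ring is `ℤ ⊕ ℤ/d`.
    have hcard : Nat.card ℤˣ = 2 := by simp
    have := isCyclicUnitsOrder_mul_of_module (R := ℤ) (d := d)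
      (by rw [hcard]; exact Nat.coprime_two_left.mpr hd)
    rwa [hcard] at this
  | fourMul d hd h =>
    -- The ring is `ℤ[i] ⊕ ℤ/d`, where `i` acts on `ℤ/d` as a square root `r` of `-1`.
    obtain ⟨r, hr⟩ := isSquare_neg_one_zmod hd.pos.ne' h
    obtain ⟨hcyc, hcard⟩ := GaussianInt.isCyclic_units_and_natCard
    let : Module GaussianInt (ZMod d) :=
      Module.compHom _ (Zsqrtd.lift ⟨r, by rw [← hr]; simp⟩ : GaussianInt →+* ZMod d)
    have := isCyclicUnitsOrder_mul_of_module (R := GaussianInt) (d := d) (by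
      rw [hcard]
      exact Nat.Coprime.pow_left 2 (Nat.coprime_two_left.mpr hd))
    rwa [hcard] at this

theorem isCyclicUnitsOrder_prod (s : Finset ℕ) (hs : ∀ n ∈ s, IsListedOrder n)
    (hc : ∀ m ∈ s, ∀ n ∈ s, m ≠ n → Nat.Coprime m n) : IsCyclicUnitsOrder (∏ n ∈ s, n) := by
  induction s using Finset.induction_on with
  | empty =>
    rw [Finset.prod_empty]
    exact (IsListedOrder.primePowSubOne 2 1 Nat.prime_two le_rfl).isCyclicUnitsOrder
  | insert a s ha ih =>
    rw [Finset.prod_insert ha]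
    refine (hs a (Finset.mem_insert_self a s)).isCyclicUnitsOrder.mul
      (ih (fun n hn ↦ hs n (Finset.mem_insert_of_mem hn)) fun m hm n hn ↦
        hc m (Finset.mem_insert_of_mem hm) n (Finset.mem_insert_of_mem hn)) ?_
    exact Nat.Coprime.prod_right fun n hn ↦ hc a (Finset.mem_insert_self a s) n
      (Finset.mem_insert_of_mem hn) fun h ↦ ha (h ▸ hn)

theorem corollary5p20 (G : Type u) [Group G] [Finite G] [IsCyclic G] :
    (∃ (R : Type v) (_ : CommRing R), Nonempty (Rˣ ≃* G)) ↔
      ∃ s : Finset ℕ, (∀ n ∈ s, IsListedOrder n) ∧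
        (∀ m ∈ s, ∀ n ∈ s, m ≠ n → Nat.Coprime m n) ∧
        Nat.card G = ∏ n ∈ s, n := by
  constructor
  · rintro ⟨R, _, ⟨φ⟩⟩
    have : Finite Rˣ := Finite.of_equiv G φ.symm.toEquiv
    have : IsCyclic Rˣ := φ.isCyclic.mpr inferInstance
    rw [← Nat.card_congr φ.toEquiv]
    exact isCoprimeProduct_natCard_units R
  · rintro ⟨s, hs, hc, hG⟩
    obtain ⟨R, _, hcyc, hcard⟩ := isCyclicUnitsOrder_prod s hs hc
    let ψ : (ULift.{v} R)ˣ ≃* Rˣ := Units.mapEquiv (ULift.ringEquiv (R := R)).toMulEquiv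
    exact ⟨ULift.{v} R, inferInstance, ⟨ψ.trans (mulEquivOfCyclicCardEq (hcard.trans hG.symm))⟩⟩
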